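/- \textbf{Theorem.} Let $Q$ be a probability measure on a measurable space $\mathcal U$ (for instance $\mathbb R^p$), let $l:\mathbb R^p\times\mathcal U\to\mathbb R$ be a loss function and let $g:\mathbb R^p\to\mathbb R$ satisfy $\mathbb E_{U\sim Q}[l(\theta,U)]=g(\theta)$ for all $\theta$ (the expectation being finite). Write $\nabla$ for the gradient in the variable $\theta$ and $|\cdot|$ for the Euclidean norm. Suppose that $l(\cdot,u)$ is twice continuously differentiable for every $u$, that there is $h_1:\mathcal U\to(0,\infty)$ with $$|\nabla l(\theta_1,u)-\nabla l(\theta_2,u)|\le h_1(u)\,|\theta_1-\theta_2|\qquad\text{for all }\theta_1,\theta_2\in\mathbb R^p,\ u\in\mathcal U,$$ and $\mathbb E_{U\sim Q}[\exp(c\,h_1(U))]<\infty$ for some $c>0$, and that $\mathbb E_{U\sim Q}|\nabla l(\theta_0,U)|^3<\infty$ for some $\theta_0$. Let $\sigma^2(\theta)$ denote the covariance matrix of $\nabla l(\theta,U)$, $U\sim Q$. Let $m=m(n)$ be positive integers such that $m\to\infty$ and $m/n\to0$ as $n\to\infty$. For each $n\ge1$ let $u_1,\dots,u_n$ be independent with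 law $Q$, and let $w=(w_1,\dots,w_n)=(w_{n,1},\dots,w_{n,n})$ be a real random vector, independent of $(u_1,\dots,u_n)$, with $$\mathbb E(w_i)=\frac1n,\qquad \mathrm{Var}(w_i)=\frac{n-m}{mn^2},\qquad \mathrm{Cov}(w_i,w_j)=-\frac{n-m}{mn^2(n-1)}\quad(i\ne j).$$ Suppose that for each $n$ the weights $w_1,\dots,w_n$ are exchangeable, nonnegative and satisfy $\sum_{i=1}^n w_i=1$ almost surely, and that, as $n\to\infty$, $$\max_{1\le i\le n}\sqrt m\,\Bigl|w_i-\frac1n\Bigr|\xrightarrow{P}0,\qquad m\sum_{i=1}^n\Bigl(w_i-\frac1n\Bigr)^2\xrightarrow{P}1 .$$ Then for every $\theta\in\mathbb R^p$, $$\sqrt m\,\Bigl(\sum_{i=1}^n w_i\,\nabla l(\theta,u_i)-\nabla g(\theta)\Bigr)\xrightarrow{d}N(0,\sigma^2(\theta))\qquad\text{as }n\to\infty .$$ -/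

import Mathlib

open MeasureTheory ProbabilityTheory Filter Topology

/-- Regularity of the loss `l θ u` in the parameter `θ`, when the datum `u` has law `Q`: it is twice
continuously differentiable in `θ`, its gradient is `h₁ u`-Lipschitz in `θ`, the gradient at some
`θ₀` has a finite third moment, and `h₁` has a finite exponential moment. -/
structure RegularLoss {p : ℕ} {U : Type*} [MeasurableSpace U]
    (l : EuclideanSpace ℝ (Fin p) → U → ℝ) (Q : Measure U) : Prop where
  contDiff : ∀ u, ContDiff ℝ 2 (fun θ => l θ u)
  exists_lipschitz : ∃ h₁ : U → ℝ, (∀ u, 0 < h₁ u) ∧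
    (∀ u θ₁ θ₂, ‖gradient (fun θ => l θ u) θ₁ - gradient (fun θ => l θ u) θ₂‖
      ≤ h₁ u * ‖θ₁ - θ₂‖) ∧
    ∃ c : ℝ, 0 < c ∧ Integrable (fun u => Real.exp (c * h₁ u)) Q
  exists_memLp : ∃ θ₀, MemLp (fun u => gradient (fun θ => l θ u) θ₀) 3 Q

/-- The loss `l` is an unbiased estimator of the objective function `g`, when the datum has
law `Q`. -/
def UnbiasedLoss {p : ℕ} {U : Type*} [MeasurableSpace U]
    (l : EuclideanSpace ℝ (Fin p) → U → ℝ) (g : EuclideanSpace ℝ (Fin p) → ℝ)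
    (Q : Measure U) : Prop :=
  ∀ θ, Integrable (l θ) Q ∧ ∫ u, l θ u ∂Q = g θ

/-- `σ²(θ)`, the covariance matrix of the random vector `∇l(θ, u)`, where `u` has law `Q`. -/
noncomputable def gradientCovariance {p : ℕ} {U : Type*} [MeasurableSpace U]
    (l : EuclideanSpace ℝ (Fin p) → U → ℝ) (Q : Measure U) (θ : EuclideanSpace ℝ (Fin p)) :
    Matrix (Fin p) (Fin p) ℝ :=
  Matrix.of fun a b =>
    covariance (fun u => gradient (fun θ' => l θ' u) θ a)
      (fun u => gradient (fun θ' => l θ' u) θ b) Q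

/-- The weight vector `w = (w₁, …, wₙ)` has the mean and the covariance matrix of the weights of
minibatch sampling with batch size `m`. -/
structure MinibatchMoments {Ω : Type*} [MeasurableSpace Ω] (P : Measure Ω) (n m : ℕ)
    (w : Fin n → Ω → ℝ) : Prop where
  memLp : ∀ i, MemLp (w i) 2 P
  mean : ∀ i, ∫ ω, w i ω ∂P = 1 / (n : ℝ)
  variance : ∀ i, variance (w i) P = ((n : ℝ) - m) / (m * (n : ℝ) ^ 2)
  covariance : ∀ i j, i ≠ j →
    covariance (w i) (w j) P = -(((n : ℝ) - m) / (m * (n : ℝ) ^ 2 * ((n : ℝ) - 1)))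

/-- A finite family of random variables is exchangeable: its joint law is invariant under every
permutation of the indices. -/
def Exchangeable {Ω : Type*} [MeasurableSpace Ω] (P : Measure Ω) {n : ℕ}
    (w : Fin n → Ω → ℝ) : Prop :=
  ∀ π : Equiv.Perm (Fin n), IdentDistrib (fun ω i => w (π i) ω) (fun ω i => w i ω) P P

/-- The conditions on the triangular array of weight vectors `w n = (w n 1, …, w n n)` with batch
sizes `m n`. There are no weights for `n = 0`, so the weights sum to one only for `n ≥ 1`. -/
structure ExchangeableWeights {Ω : Type*} [MeasurableSpace Ω] (P : Measure Ω) (m : ℕ → ℕ)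
    (w : (n : ℕ) → Fin n → Ω → ℝ) : Prop where
  exchangeable : ∀ n, Exchangeable P (w n)
  nonneg : ∀ n i, ∀ᵐ ω ∂P, 0 ≤ w n i ω
  sum_eq_one : ∀ n, 1 ≤ n → ∀ᵐ ω ∂P, ∑ i, w n i ω = 1
  max_tendsto : TendstoInMeasure P
    (fun n ω => ⨆ i : Fin n, √(m n : ℝ) * |w n i ω - 1 / (n : ℝ)|) atTop (fun _ => (0 : ℝ))
  sum_sq_tendsto : TendstoInMeasure P
    (fun n ω => (m n : ℝ) * ∑ i : Fin n, (w n i ω - 1 / (n : ℝ)) ^ 2) atTop (fun _ => (1 : ℝ))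

/-!
Since the weights sum to one, the rescaled error is the weighted sum `∑ bᵢ Yᵢ` with weights
`bᵢ = √m wᵢ` and independent centered vectors `Yᵢ = ∇l(θ, uᵢ) - ∇g(θ)`. The `Yᵢ` are
square-integrable (`RegularLoss.memLp_gradient`) because `h₁` has moments of every order, and they
are centered (`UnbiasedLoss.integral_gradient`) because the Lipschitz bound on the gradient allows
differentiation under the integral sign. The hypotheses on the weights, together with `m / n → 0`,
give `max |bᵢ| → 0` and `∑ bᵢ² → 1` in probability.

It remains to prove a central limit theorem with independent random weights
(`tendstoInDistribution_sum_smul`). By independence, the characteristic function of the sum at `t`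
is `𝔼 ∏ φ(bᵢ t)`, where `φ` is that of `Yᵢ` (`charFun_map_sum_smul`). As
`φ(s t) = exp(-s² v / 2) + o(s²)`, where `v` is the variance of `⟪t, Yᵢ⟫`, the product is close to
`exp(-v ∑ bᵢ² / 2)` when `max |bᵢ|` is small and `∑ bᵢ²` bounded (`tendsto_prod_charFun`). So it tends to
`exp(-v / 2)` in probability, its expectation converges by bounded convergence, and Lévy's theorem
concludes.
-/

open scoped RealInnerProductSpace Matrix

/-! ### Products of values of a characteristic function near zero -/

lemma norm_prod_sub_prod_le_sum_norm_sub {ι : Type*} (s : Finset ι) {a b : ι → ℂ}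
    (ha : ∀ i ∈ s, ‖a i‖ ≤ 1) (hb : ∀ i ∈ s, ‖b i‖ ≤ 1) :
    ‖∏ i ∈ s, a i - ∏ i ∈ s, b i‖ ≤ ∑ i ∈ s, ‖a i - b i‖ := by
  classical
  induction s using Finset.induction_on with
  | empty => simp
  | insert j s hj ih =>
    rw [Finset.forall_mem_insert] at ha hb
    rw [Finset.prod_insert hj, Finset.prod_insert hj, Finset.sum_insert hj]
    have hbs : ‖∏ i ∈ s, b i‖ ≤ 1 := by
      rw [norm_prod]
      exact Finset.prod_le_one (fun _ _ => norm_nonneg _) hb.2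
    calc ‖a j * ∏ i ∈ s, a i - b j * ∏ i ∈ s, b i‖
        = ‖(a j - b j) * ∏ i ∈ s, b i + a j * (∏ i ∈ s, a i - ∏ i ∈ s, b i)‖ := by
          congr 1; ring
      _ ≤ ‖a j - b j‖ * ‖∏ i ∈ s, b i‖ + ‖a j‖ * ‖∏ i ∈ s, a i - ∏ i ∈ s, b i‖ := by
          rw [← norm_mul, ← norm_mul]; exact norm_add_le _ _
      _ ≤ ‖a j - b j‖ * 1 + 1 * ∑ i ∈ s, ‖a i - b i‖ := by
          gcongr
          · exact ha.1
          · exact ih ha.2 hb.2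
      _ = _ := by ring

/-- Near zero, a centered law with variance `v` has the characteristic function of the Gaussian law
with variance `v`, up to an error `o(s²)`. -/
lemma charFun_sub_exp_isLittleO {μ : Measure ℝ} [IsProbabilityMeasure μ] (h2 : MemLp id 2 μ)
    (h0 : ∫ x, x ∂μ = 0) :
    (fun s : ℝ => charFun μ s - Complex.exp (-((s ^ 2 * (∫ x, x ^ 2 ∂μ) / 2 : ℝ) : ℂ)))
      =o[𝓝 0] fun s => s ^ 2 := by
  set v : ℝ := ∫ x, x ^ 2 ∂μ with hv
  -- Both functions agree with `1 - s² v / 2` up to `o(s²)`.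
  have h1 : (fun s : ℝ => charFun μ s - (1 - ((s ^ 2 * v / 2 : ℝ) : ℂ))) =o[𝓝 0]
      fun s => s ^ 2 := by
    have key := taylor_isLittleO_univ (x₀ := (0 : ℝ))
      (contDiff_charFun (n := 2) (by simpa using h2))
    refine (key.congr (fun s => ?_) (fun s => by rw [sub_zero]))
    rw [taylorWithinEval_charFun_zero (n := 2) (by simpa using h2)]
    simp only [Finset.sum_range_succ, Finset.range_one, Finset.sum_singleton]
    simp only [pow_one, h0, ← hv]
    simp [Nat.factorial, mul_pow]
    ring
  have h3 : (fun s : ℝ => Complex.exp (-((s ^ 2 * v / 2 : ℝ) : ℂ)) -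
      (1 - ((s ^ 2 * v / 2 : ℝ) : ℂ))) =o[𝓝 0] fun s => s ^ 2 := by
    have hexp : (fun z : ℂ => Complex.exp z - 1 - z) =o[𝓝 0] fun z => z := by
      have := (Complex.hasDerivAt_exp 0).isLittleO
      simpa using this
    have hlim : Tendsto (fun s : ℝ => -((s ^ 2 * v / 2 : ℝ) : ℂ)) (𝓝 0) (𝓝 0) := by
      have : Continuous (fun s : ℝ => -((s ^ 2 * v / 2 : ℝ) : ℂ)) := by fun_prop
      simpa using this.tendsto 0
    have hO : (fun s : ℝ => -((s ^ 2 * v / 2 : ℝ) : ℂ)) =O[𝓝 0] fun s => s ^ 2 := by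
      refine Asymptotics.IsBigO.of_bound (|v / 2|) (Eventually.of_forall fun s => ?_)
      rw [norm_neg, Complex.norm_real, mul_div_assoc, norm_mul, mul_comm, Real.norm_eq_abs]
    refine ((hexp.comp_tendsto hlim).trans_isBigO hO).congr_left fun s => ?_
    simp only [Function.comp_apply]
    ring
  refine (h1.sub h3).congr_left fun s => ?_
  ring

/-- **Lindeberg condition for deterministic weights.** If the largest weight tends to zero and the
squares of the weights have a sum tending to one, then the product of the values at the weights of
the characteristic function of a centered law tends to that of the Gaussian law at `1`. -/
lemma tendsto_prod_charFun {α : Type*} {F : Filter α} {κ : α → Type*} [∀ a, Fintype (κ a)]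
    {μ : Measure ℝ} [IsProbabilityMeasure μ] (h2 : MemLp id 2 μ) (h0 : ∫ x, x ∂μ = 0)
    {b : (a : α) → κ a → ℝ} (hmax : ∀ ε > 0, ∀ᶠ a in F, ∀ i, |b a i| < ε)
    (hsq : Tendsto (fun a => ∑ i, b a i ^ 2) F (𝓝 1)) :
    Tendsto (fun a => ∏ i, charFun μ (b a i)) F
      (𝓝 (Complex.exp (-(((∫ x, x ^ 2 ∂μ) / 2 : ℝ) : ℂ)))) := by
  set v : ℝ := ∫ x, x ^ 2 ∂μ with hv
  have hv0 : 0 ≤ v := integral_nonneg fun x => sq_nonneg x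
  have hgauss : Tendsto (fun a => ∏ i, Complex.exp (-((b a i ^ 2 * v / 2 : ℝ) : ℂ))) F
      (𝓝 (Complex.exp (-((v / 2 : ℝ) : ℂ)))) := by
    have hc : Continuous fun x : ℝ => Complex.exp (-((x * v / 2 : ℝ) : ℂ)) := by fun_prop
    have := (hc.tendsto 1).comp hsq
    rw [one_mul] at this
    refine this.congr fun a => ?_
    rw [Function.comp_apply, ← Complex.exp_sum]
    congr 1
    push_cast
    rw [Finset.sum_mul, Finset.sum_div, Finset.sum_neg_distrib]
  have hdiff : Tendsto (fun a => ∏ i, charFun μ (b a i) -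
      ∏ i, Complex.exp (-((b a i ^ 2 * v / 2 : ℝ) : ℂ))) F (𝓝 0) := by
    rw [Metric.tendsto_nhds]
    intro ε hε
    obtain ⟨δ, hδ, hball⟩ := Metric.eventually_nhds_iff.1
      ((charFun_sub_exp_isLittleO h2 h0).def (half_pos hε))
    filter_upwards [hmax δ hδ, hsq.eventually_lt_const (by norm_num : (1 : ℝ) < 2)] with a ha hs
    rw [dist_zero_right]
    calc _ ≤ ∑ i, ‖charFun μ (b a i) - Complex.exp (-((b a i ^ 2 * v / 2 : ℝ) : ℂ))‖ := by
          refine norm_prod_sub_prod_le_sum_norm_sub _ (fun i _ => norm_charFun_le_one _)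
            fun i _ => ?_
          rw [Complex.norm_exp, ← Complex.ofReal_neg, Complex.ofReal_re]
          exact Real.exp_le_one_iff.2 (neg_nonpos.2 (by positivity))
      _ ≤ ∑ i, ε / 2 * b a i ^ 2 := by
          refine Finset.sum_le_sum fun i _ => ?_
          have := hball (y := b a i) (by simpa using ha i)
          rwa [Real.norm_of_nonneg (sq_nonneg _)] at this
      _ = ε / 2 * ∑ i, b a i ^ 2 := by rw [Finset.mul_sum]
      _ < ε / 2 * 2 := by gcongr
      _ = ε := by ring
  simpa using hdiff.add hgauss

/-! ### Sums of independent vectors with independent random weights -/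

section WeightedSum

variable {E : Type*} [NormedAddCommGroup E] [InnerProductSpace ℝ E] [MeasurableSpace E]
  [BorelSpace E] [SecondCountableTopology E]
  {Ω : Type*} [MeasurableSpace Ω] {P : Measure Ω} [IsProbabilityMeasure P]

/-- Conditionally on the weights, a weighted sum of independent vectors with law `μ` has a product
of rescaled copies of the characteristic function of `μ` as its characteristic function. -/
lemma charFun_map_sum_smul {ι : Type*} [Fintype ι] {μ : Measure E} [IsProbabilityMeasure μ]
    {W : ι → Ω → ℝ} {Y : ι → Ω → E} (hW : ∀ i, AEMeasurable (W i) P)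
    (hY : ∀ i, HasLaw (Y i) μ P) (hYi : iIndepFun Y P)
    (hWY : IndepFun (fun ω i => W i ω) (fun ω i => Y i ω) P) (t : E) :
    charFun (P.map fun ω => ∑ i, W i ω • Y i ω) t = ∫ ω, ∏ i, charFun μ (W i ω • t) ∂P := by
  have hWm : AEMeasurable (fun ω i => W i ω) P := aemeasurable_pi_lambda _ hW
  have hYm : AEMeasurable (fun ω i => Y i ω) P :=
    aemeasurable_pi_lambda _ fun i => (hY i).aemeasurable
  have := Measure.isProbabilityMeasure_map hWm
  have hsum : AEMeasurable (fun ω => ∑ i, W i ω • Y i ω) P :=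
    Finset.aemeasurable_fun_sum _ fun i _ => (hW i).smul (hY i).aemeasurable
  let φ : (ι → ℝ) × (ι → E) → ℂ :=
    fun z => ∏ i, Complex.exp ((⟪z.2 i, z.1 i • t⟫ : ℝ) * Complex.I)
  have hφm : Measurable φ := by
    refine Finset.measurable_fun_prod _ fun i _ => ?_
    have h1 : Measurable fun z : (ι → ℝ) × (ι → E) => z.1 i := by fun_prop
    have h2 : Measurable fun z : (ι → ℝ) × (ι → E) => z.2 i := by fun_prop
    have h3 : Measurable fun z : (ι → ℝ) × (ι → E) => (⟪z.2 i, z.1 i • t⟫ : ℝ) :=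
      h2.inner (h1.smul_const t)
    fun_prop
  have hφ1 : ∀ z, ‖φ z‖ ≤ 1 := fun z => by
    simp [φ, norm_prod, Complex.norm_exp_ofReal_mul_I]
  have hprod := (iIndepFun_iff_map_fun_eq_pi_map fun i => (hY i).aemeasurable).1 hYi
  simp_rw [fun i => (hY i).map_eq] at hprod
  have hjoint := (indepFun_iff_map_prod_eq_prod_map_map hWm hYm).1 hWY
  rw [hprod] at hjoint
  have hW' : ∀ x : ι → ℝ, ∫ y, φ (x, y) ∂(Measure.pi fun _ : ι => μ) =
      ∏ i, charFun μ (x i • t) := fun x =>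
    integral_fintype_prod_eq_prod (μ := fun _ : ι => μ)
      (fun i y => Complex.exp ((⟪y, x i • t⟫ : ℝ) * Complex.I))
  calc charFun (P.map fun ω => ∑ i, W i ω • Y i ω) t
      = ∫ ω, φ (fun i => W i ω, fun i => Y i ω) ∂P := by
        rw [charFun_apply, integral_map hsum (by fun_prop)]
        refine integral_congr_ae (Eventually.of_forall fun ω => ?_)
        simp only [φ]
        rw [← Complex.exp_sum, ← Finset.sum_mul, sum_inner]
        push_cast
        simp_rw [real_inner_smul_left, real_inner_smul_right]
    _ = ∫ z, φ z ∂((P.map fun ω i => W i ω).prod (Measure.pi fun _ : ι => μ)) := by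
        rw [← hjoint, integral_map (hWm.prodMk hYm) hφm.aestronglyMeasurable]
    _ = ∫ x, ∫ y, φ (x, y) ∂(Measure.pi fun _ : ι => μ) ∂(P.map fun ω i => W i ω) :=
        integral_prod _ (Integrable.of_bound hφm.aestronglyMeasurable 1
          (Eventually.of_forall hφ1))
    _ = ∫ ω, ∏ i, charFun μ (W i ω • t) ∂P := by
        simp_rw [hW']
        rw [integral_map hWm]
        refine (Finset.measurable_fun_prod _ fun i _ => ?_).aestronglyMeasurable
        have : Measurable (charFun μ) := measurable_charFun
        exact this.comp ((measurable_pi_apply i).smul_const t)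

lemma charFun_smul_eq_charFun_map_inner {μ : Measure E} (t : E) (s : ℝ) :
    charFun μ (s • t) = charFun (μ.map fun x => (⟪t, x⟫ : ℝ)) s := by
  rw [charFun_apply, charFun_apply, integral_map (by fun_prop) (by fun_prop)]
  simp_rw [real_inner_smul_right, real_inner_comm, RCLike.inner_apply, conj_trivial, mul_comm s]

/-- **Central limit theorem with random weights.** For each `n`, let the vectors `Y n i` be
independent with a centered square-integrable law `μ`, and independent of the weights `W n i`. If in probability the
largest weight tends to zero and the squares of the weights have a sum tending to one, then the
weighted sums converge in distribution to the centered Gaussian law with the covariance of `μ`. The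
largest weight appears through an upper bound `D n`. -/
theorem tendstoInDistribution_sum_smul [FiniteDimensional ℝ E] {μ γ : Measure E}
    [IsProbabilityMeasure μ] [IsGaussian γ] (h2 : MemLp id 2 μ) (h0 : ∫ x, x ∂μ = 0)
    (hγ0 : ∫ x, x ∂γ = 0) (hγ : ∀ t, covarianceBilin γ t t = covarianceBilin μ t t)
    {κ : ℕ → Type*} [∀ n, Fintype (κ n)] {W : (n : ℕ) → κ n → Ω → ℝ} {Y : (n : ℕ) → κ n → Ω → E}
    (hW : ∀ n i, AEMeasurable (W n i) P) (hY : ∀ n i, HasLaw (Y n i) μ P)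
    (hYi : ∀ n, iIndepFun (Y n) P)
    (hWY : ∀ n, IndepFun (fun ω i => W n i ω) (fun ω i => Y n i ω) P)
    {D : ℕ → Ω → ℝ} (hWD : ∀ n i ω, |W n i ω| ≤ D n ω)
    (hD : TendstoInMeasure P D atTop fun _ => 0)
    (hsq : TendstoInMeasure P (fun n ω => ∑ i, W n i ω ^ 2) atTop fun _ => 1)
    {X : ℕ → Ω → E} (hXm : ∀ n, AEMeasurable (X n) P)
    (hX : ∀ᶠ n in atTop, X n =ᵐ[P] fun ω => ∑ i, W n i ω • Y n i ω) :
    TendstoInDistribution X atTop id (fun _ => P) γ := by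
  have := FiniteDimensional.complete ℝ E
  refine ⟨hXm, aemeasurable_id, ?_⟩
  refine ProbabilityMeasure.tendsto_iff_tendsto_charFun.2 fun t => ?_
  set ν : Measure ℝ := μ.map fun x => (⟪t, x⟫ : ℝ) with hν
  have : IsProbabilityMeasure ν := Measure.isProbabilityMeasure_map (by fun_prop)
  have hν2 : MemLp id 2 ν :=
    (memLp_map_measure_iff (by fun_prop) (by fun_prop)).2 (h2.const_inner t)
  have hν0 : ∫ x, x ∂ν = 0 := by
    rw [hν, integral_map (by fun_prop) (by fun_prop),
      integral_inner (f := fun x : E => x) (h2.integrable one_le_two), h0, inner_zero_right]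
  have hνv : ∫ x, x ^ 2 ∂ν = covarianceBilin μ t t := by
    rw [covarianceBilin_apply h2, hν, integral_map (by fun_prop) (by fun_prop)]
    simp [h0, sq]
  have hlim : charFun γ t = Complex.exp (-(((∫ x, x ^ 2 ∂ν) / 2 : ℝ) : ℂ)) := by
    rw [IsGaussian.charFun_eq', hγ, hνv]
    simp [hγ0]
  have hpre : ∀ᶠ n in atTop, ∫ ω, ∏ i, charFun ν (W n i ω) ∂P = charFun (P.map (X n)) t := by
    filter_upwards [hX] with n hn
    rw [Measure.map_congr hn, charFun_map_sum_smul (hW n) (hY n) (hYi n) (hWY n)]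
    simp_rw [charFun_smul_eq_charFun_map_inner]
    rfl
  suffices h : Tendsto (fun n => ∫ ω, ∏ i, charFun ν (W n i ω) ∂P) atTop
      (𝓝 (Complex.exp (-(((∫ x, x ^ 2 ∂ν) / 2 : ℝ) : ℂ)))) by
    rw [← hlim] at h
    simpa using h.congr' hpre
  -- Along a subsequence the weights converge almost surely, and dominated convergence applies.
  refine tendsto_of_subseq_tendsto fun ns hns => ?_
  obtain ⟨k₁, hk₁, hD'⟩ := (hD.comp hns).exists_seq_tendsto_ae
  obtain ⟨k₂, hk₂, hsq'⟩ := ((hsq.comp hns).comp hk₁.tendsto_atTop).exists_seq_tendsto_ae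
  refine ⟨fun j => k₁ (k₂ j), ?_⟩
  have hlimint := tendsto_integral_of_dominated_convergence (μ := P)
    (F := fun j ω => ∏ i, charFun ν (W (ns (k₁ (k₂ j))) i ω))
    (f := fun _ => Complex.exp (-(((∫ x, x ^ 2 ∂ν) / 2 : ℝ) : ℂ))) (fun _ => 1)
    (fun j => ?_) (integrable_const _) (fun j => Eventually.of_forall fun ω => ?_) ?_
  · simpa using hlimint
  · exact (Finset.aemeasurable_fun_prod _ fun i _ =>
      (measurable_charFun (μ := ν)).comp_aemeasurable (hW _ i)).aestronglyMeasurable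
  · rw [norm_prod]
    exact Finset.prod_le_one (fun _ _ => norm_nonneg _) fun _ _ => norm_charFun_le_one _
  · filter_upwards [hD', hsq'] with ω h1 h3
    refine tendsto_prod_charFun hν2 hν0 (fun ε hε => ?_) h3
    filter_upwards [(h1.comp hk₂.tendsto_atTop).eventually_lt_const hε] with j hj i
    exact (hWD _ i ω).trans_lt hj

end WeightedSum

/-! ### The gradient of the loss as a random vector -/

section Gradient

variable {p : ℕ} {U : Type*} [MeasurableSpace U] {l : EuclideanSpace ℝ (Fin p) → U → ℝ}
  {g : EuclideanSpace ℝ (Fin p) → ℝ} {Q : Measure U}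

lemma RegularLoss.differentiable (hl : RegularLoss l Q) (u : U) :
    Differentiable ℝ fun θ => l θ u :=
  (hl.contDiff u).differentiable two_ne_zero

/-- The coordinates of the gradient are limits of difference quotients along the sequence `1/n`. -/
lemma RegularLoss.aestronglyMeasurable_gradient (hl : RegularLoss l Q)
    (hm : ∀ θ, AEStronglyMeasurable (l θ) Q) (θ : EuclideanSpace ℝ (Fin p)) :
    AEStronglyMeasurable (fun u => gradient (fun θ' => l θ' u) θ) Q := by
  have hcoord : ∀ v, AEStronglyMeasurable
      (fun u => (⟪v, gradient (fun θ' => l θ' u) θ⟫ : ℝ)) Q := by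
    intro v
    refine aestronglyMeasurable_of_tendsto_ae (u := atTop)
      (f := fun (n : ℕ) u => (n : ℝ) * (l (θ + (n : ℝ)⁻¹ • v) u - l θ u))
      (fun n => ((hm _).sub (hm _)).const_mul _) (Eventually.of_forall fun u => ?_)
    have hd := (hl.differentiable u θ).hasFDerivAt
    have hn : Tendsto (fun n : ℕ => ‖(n : ℝ)‖) atTop atTop :=
      tendsto_norm_atTop_atTop.comp tendsto_natCast_atTop_atTop
    simpa [inner_gradient_right] using hd.lim v hn
  have hsum : (fun u => gradient (fun θ' => l θ' u) θ) = fun u =>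
      ∑ i, (⟪EuclideanSpace.basisFun (Fin p) ℝ i, gradient (fun θ' => l θ' u) θ⟫ : ℝ) •
        EuclideanSpace.basisFun (Fin p) ℝ i :=
    funext fun u => ((EuclideanSpace.basisFun (Fin p) ℝ).sum_repr' _).symm
  rw [hsum]
  exact Finset.aestronglyMeasurable_fun_sum _ fun i _ => (hcoord _).smul_const _

/-- Measurability of `h` is recovered from that of `exp (c * h)` by taking logarithms. -/
lemma memLp_two_of_integrable_exp {h : U → ℝ} (h0 : ∀ u, 0 ≤ h u) {c : ℝ} (hc : 0 < c)
    (hint : Integrable (fun u => Real.exp (c * h u)) Q) : MemLp h 2 Q := by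
  have hm : AEMeasurable h Q := by
    have := (Real.measurable_log.comp_aemeasurable hint.aemeasurable).const_mul c⁻¹
    refine this.congr (Eventually.of_forall fun u => ?_)
    simp [hc.ne']
  rw [memLp_two_iff_integrable_sq hm.aestronglyMeasurable]
  refine (hint.const_mul (2 / c ^ 2)).mono' (hm.pow_const 2).aestronglyMeasurable
    (Eventually.of_forall fun u => ?_)
  have h1 := Real.quadratic_le_exp_of_nonneg (mul_nonneg hc.le (h0 u))
  have h2 : (c * h u) ^ 2 ≤ 2 * Real.exp (c * h u) := by
    nlinarith [mul_nonneg hc.le (h0 u)]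
  rw [Real.norm_of_nonneg (sq_nonneg _), div_mul_eq_mul_div, le_div_iff₀ (by positivity)]
  linarith [mul_pow c (h u) 2]

lemma RegularLoss.memLp_gradient [IsFiniteMeasure Q] (hl : RegularLoss l Q)
    (hm : ∀ θ, AEStronglyMeasurable (l θ) Q) (θ : EuclideanSpace ℝ (Fin p)) :
    MemLp (fun u => gradient (fun θ' => l θ' u) θ) 2 Q := by
  obtain ⟨h₁, hpos, hlip, c, hc, hint⟩ := hl.exists_lipschitz
  obtain ⟨θ₀, hθ₀⟩ := hl.exists_memLp
  have h2 : MemLp (fun u => gradient (fun θ' => l θ' u) θ₀) 2 Q :=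
    hθ₀.mono_exponent (by norm_num)
  have h3 := (memLp_two_of_integrable_exp (fun u => (hpos u).le) hc hint).mul_const ‖θ - θ₀‖
  refine (h2.norm.add h3).mono (hl.aestronglyMeasurable_gradient hm θ)
    (Eventually.of_forall fun u => ?_)
  simp only [Pi.add_apply]
  calc ‖gradient (fun θ' => l θ' u) θ‖
      ≤ ‖gradient (fun θ' => l θ' u) θ₀‖ +
          ‖gradient (fun θ' => l θ' u) θ - gradient (fun θ' => l θ' u) θ₀‖ := by
        rw [add_comm]; exact norm_le_norm_sub_add _ _
    _ ≤ ‖gradient (fun θ' => l θ' u) θ₀‖ + h₁ u * ‖θ - θ₀‖ := by gcongr; exact hlip u θ θ₀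
    _ ≤ _ := le_abs_self _

/-- On a unit ball the loss is Lipschitz with an integrable constant, so that the expectation may
be differentiated under the integral sign. -/
lemma UnbiasedLoss.integral_gradient [IsFiniteMeasure Q] (hlg : UnbiasedLoss l g Q)
    (hl : RegularLoss l Q) (θ : EuclideanSpace ℝ (Fin p)) :
    ∫ u, gradient (fun θ' => l θ' u) θ ∂Q = gradient g θ := by
  have hm : ∀ θ, AEStronglyMeasurable (l θ) Q := fun θ => (hlg θ).1.aestronglyMeasurable
  have hL2 := hl.memLp_gradient hm θ
  have hG : Integrable (fun u => gradient (fun θ' => l θ' u) θ) Q := hL2.integrable one_le_two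
  obtain ⟨h₁, hpos, hlip, c, hc, hint⟩ := hl.exists_lipschitz
  have hh₁ : Integrable h₁ Q :=
    (memLp_two_of_integrable_exp (fun u => (hpos u).le) hc hint).integrable one_le_two
  have hnorm : ∀ u θ', ‖fderiv ℝ (fun θ'' => l θ'' u) θ'‖ = ‖gradient (fun θ'' => l θ'' u) θ'‖ :=
    fun u θ' => by rw [← toDual_gradient, LinearIsometryEquiv.norm_map]
  have hmeas : AEStronglyMeasurable (fun u => fderiv ℝ (fun θ' => l θ' u) θ) Q := by
    have := (InnerProductSpace.toDual ℝ (EuclideanSpace ℝ (Fin p))).continuous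
      |>.comp_aestronglyMeasurable hG.aestronglyMeasurable
    simpa only [toDual_gradient] using this
  have hloc : ∀ u, LipschitzOnWith (Real.nnabs (‖gradient (fun θ' => l θ' u) θ‖ + h₁ u))
      (fun θ => l θ u) (Metric.ball θ 1) := by
    refine fun u => (convex_ball θ 1).lipschitzOnWith_of_nnnorm_fderiv_le
      (fun θ' _ => hl.differentiable u θ') fun θ' hθ' => ?_
    have h0 : 0 ≤ ‖gradient (fun θ' => l θ' u) θ‖ + h₁ u :=
      add_nonneg (norm_nonneg _) (hpos u).le
    rw [← NNReal.coe_le_coe, coe_nnnorm, hnorm, Real.coe_nnabs, abs_of_nonneg h0]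
    rw [mem_ball_iff_norm] at hθ'
    calc ‖gradient (fun θ'' => l θ'' u) θ'‖
        ≤ ‖gradient (fun θ' => l θ' u) θ‖ +
            ‖gradient (fun θ'' => l θ'' u) θ' - gradient (fun θ' => l θ' u) θ‖ := by
          rw [add_comm]; exact norm_le_norm_sub_add _ _
      _ ≤ ‖gradient (fun θ' => l θ' u) θ‖ + h₁ u * ‖θ' - θ‖ := by gcongr; exact hlip u θ' θ
      _ ≤ ‖gradient (fun θ' => l θ' u) θ‖ + h₁ u * 1 := by
          have := (hpos u).le
          gcongr
      _ = _ := by rw [mul_one]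
  obtain ⟨hFint, hF⟩ := hasFDerivAt_integral_of_dominated_loc_of_lip (𝕜 := ℝ)
    (Metric.ball_mem_nhds θ one_pos) (Eventually.of_forall hm) (hlg θ).1 hmeas
    (Eventually.of_forall hloc) (hG.norm.add hh₁)
    (Eventually.of_forall fun u => (hl.differentiable u θ).hasFDerivAt)
  rw [show (fun θ => ∫ u, l θ u ∂Q) = g from funext fun θ => (hlg θ).2] at hF
  refine ext_inner_right ℝ fun v => ?_
  rw [inner_gradient_left, hF.fderiv, ContinuousLinearMap.integral_apply hFint,
    real_inner_comm, ← integral_inner hG]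
  simp [inner_gradient_right]

lemma covarianceBilin_map_gradient [IsFiniteMeasure Q] {θ : EuclideanSpace ℝ (Fin p)}
    (hG : MemLp (fun u => gradient (fun θ' => l θ' u) θ) 2 Q) (x : EuclideanSpace ℝ (Fin p)) :
    covarianceBilin (Q.map fun u => gradient (fun θ' => l θ' u) θ) x x =
      x ⬝ᵥ gradientCovariance l Q θ *ᵥ x := by
  have h := covarianceBilin_apply_pi (μ := Q)
    (X := fun i u => gradient (fun θ' => l θ' u) θ i) (fun i => hG.eval_piLp i) x x
  simp only [WithLp.toLp_ofLp] at h
  rw [h]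
  simp only [dotProduct, Matrix.mulVec, gradientCovariance, Matrix.of_apply, Finset.mul_sum]
  exact Finset.sum_congr rfl fun i _ => Finset.sum_congr rfl fun j _ => by ring

lemma gradientCovariance_posSemidef [IsFiniteMeasure Q] {θ : EuclideanSpace ℝ (Fin p)}
    (hG : MemLp (fun u => gradient (fun θ' => l θ' u) θ) 2 Q) :
    (gradientCovariance l Q θ).PosSemidef := by
  refine Matrix.PosSemidef.of_dotProduct_mulVec_nonneg ?_ fun x => ?_
  · ext i j
    simp [gradientCovariance, covariance_comm]
  · have h := covarianceBilin_map_gradient hG (WithLp.toLp 2 x)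
    simpa using h ▸ covarianceBilin_self_nonneg (WithLp.toLp 2 x)

end Gradient

/-! ### Convergence of the rescaled weights -/

lemma MeasureTheory.TendstoInMeasure.add_const_tendsto_zero {Ω : Type*} [MeasurableSpace Ω]
    {P : Measure Ω} {f : ℕ → Ω → ℝ} {f' : Ω → ℝ} (hf : TendstoInMeasure P f atTop f') {c : ℕ → ℝ}
    (hc : Tendsto c atTop (𝓝 0)) : TendstoInMeasure P (fun n ω => f n ω + c n) atTop f' := by
  rw [tendstoInMeasure_iff_norm] at hf ⊢
  intro ε hε
  refine tendsto_of_tendsto_of_tendsto_of_le_of_le' tendsto_const_nhds (hf (ε / 2) (half_pos hε))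
    (Eventually.of_forall fun _ => zero_le) ?_
  filter_upwards [hc.norm.eventually_lt_const (by simpa using half_pos hε : ‖(0 : ℝ)‖ < ε / 2)]
    with n hn
  refine measure_mono fun ω (hω : ε ≤ _) => ?_
  have : ‖f n ω + c n - f' ω‖ ≤ ‖f n ω - f' ω‖ + ‖c n‖ := by
    rw [add_sub_right_comm]; exact norm_add_le _ _
  show ε / 2 ≤ _
  linarith

/-- Since the weights sum to one, `m ∑ wᵢ² = m ∑ (wᵢ - 1/n)² + m/n`. -/
lemma ExchangeableWeights.tendstoInMeasure_sum_sq {Ω : Type*} [MeasurableSpace Ω] {P : Measure Ω}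
    {m : ℕ → ℕ} {w : (n : ℕ) → Fin n → Ω → ℝ} (hw : ExchangeableWeights P m w)
    (hmn : Tendsto (fun n => (m n : ℝ) / (n : ℝ)) atTop (𝓝 0)) :
    TendstoInMeasure P (fun n ω => ∑ i, (√(m n : ℝ) * w n i ω) ^ 2) atTop fun _ => 1 := by
  refine (hw.sum_sq_tendsto.add_const_tendsto_zero hmn).congr' ?_ EventuallyEq.rfl
  filter_upwards [eventually_ge_atTop 1] with n hn
  filter_upwards [hw.sum_eq_one n hn] with ω hω
  have hn0 : (n : ℝ) ≠ 0 := by positivity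
  simp only [mul_pow, Real.sq_sqrt (Nat.cast_nonneg _), sub_sq]
  rw [← Finset.mul_sum, Finset.sum_add_distrib, Finset.sum_sub_distrib, ← Finset.sum_mul,
    ← Finset.mul_sum, hω]
  simp
  field_simp
  ring

/-! ### Asymptotic normality of the weighted gradient -/

theorem mainTheorem6 {p : ℕ} {U : Type*} [MeasurableSpace U] (Q : Measure U)
    [IsProbabilityMeasure Q] (l : EuclideanSpace ℝ (Fin p) → U → ℝ)
    (g : EuclideanSpace ℝ (Fin p) → ℝ) (hl : RegularLoss l Q) (hlg : UnbiasedLoss l g Q)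
    {Ω : Type*} [MeasurableSpace Ω] (P : Measure Ω) [IsProbabilityMeasure P]
    (u : (n : ℕ) → Fin n → Ω → U) (hu_law : ∀ n i, HasLaw (u n i) Q P)
    (hu_indep : ∀ n, iIndepFun (u n) P)
    (m : ℕ → ℕ) (hm : Tendsto m atTop atTop)
    (hmn : Tendsto (fun n => (m n : ℝ) / (n : ℝ)) atTop (𝓝 0))
    (w : (n : ℕ) → Fin n → Ω → ℝ)
    (hw_moments : ∀ n, MinibatchMoments P n (m n) (w n))
    (hw : ExchangeableWeights P m w)
    (hwu : ∀ n, IndepFun (fun ω i => w n i ω) (fun ω i => u n i ω) P)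
    (θ : EuclideanSpace ℝ (Fin p)) :
    TendstoInDistribution
      (fun n ω => √(m n : ℝ) •
        ((∑ i : Fin n, w n i ω • gradient (fun θ' => l θ' (u n i ω)) θ) - gradient g θ))
      atTop id (fun _ => P) (multivariateGaussian 0 (gradientCovariance l Q θ)) := by
  let G : U → EuclideanSpace ℝ (Fin p) := fun v => gradient (fun θ' => l θ' v) θ
  have hG2 : MemLp G 2 Q := hl.memLp_gradient (fun θ => (hlg θ).1.aestronglyMeasurable) θ
  have hGmean : ∫ v, G v ∂Q = gradient g θ := hlg.integral_gradient hl θ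
  have hGm : AEMeasurable G Q := hG2.aestronglyMeasurable.aemeasurable
  -- A measurable version of the centered gradient, so that it preserves independence.
  obtain ⟨H, hHm, hHG⟩ : ∃ H : U → EuclideanSpace ℝ (Fin p),
      Measurable H ∧ H =ᵐ[Q] fun v => -gradient g θ + G v :=
    ⟨_, (hGm.const_add _).measurable_mk, (hGm.const_add _).ae_eq_mk.symm⟩
  set μ : Measure (EuclideanSpace ℝ (Fin p)) := Q.map H with hμ
  have : IsProbabilityMeasure μ := Measure.isProbabilityMeasure_map hHm.aemeasurable
  have hμmap : μ = (Q.map G).map fun x => -gradient g θ + x := by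
    rw [hμ, Measure.map_congr hHG,
      AEMeasurable.map_map_of_aemeasurable (by fun_prop) hGm, Function.comp_def]
  have hμ2 : MemLp id 2 μ := by
    rw [hμ, memLp_map_measure_iff (by fun_prop) hHm.aemeasurable]
    exact (memLp_congr_ae hHG).2 ((memLp_const (-gradient g θ)).add hG2)
  have hμ0 : ∫ x, x ∂μ = 0 := by
    rw [hμ, integral_map hHm.aemeasurable (by fun_prop), integral_congr_ae hHG,
      integral_add (integrable_const _) (hG2.integrable one_le_two), hGmean]
    simp
  have : IsProbabilityMeasure (Q.map G) := Measure.isProbabilityMeasure_map hGm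
  have hcov : ∀ t, covarianceBilin (multivariateGaussian 0 (gradientCovariance l Q θ)) t t =
      covarianceBilin μ t t := fun t => by
    rw [covarianceBilin_multivariateGaussian (gradientCovariance_posSemidef hG2), hμmap,
      covarianceBilin_map_const_add (μ := Q.map G) (-gradient g θ)]
    exact (covarianceBilin_map_gradient hG2 t).symm
  have hwm : ∀ n i, AEMeasurable (w n i) P := fun n i =>
    ((hw_moments n).memLp i).aestronglyMeasurable.aemeasurable
  have hum : ∀ n i, AEMeasurable (u n i) P := fun n i => (hu_law n i).aemeasurable
  have hsqrt : Tendsto (fun n => √(m n : ℝ) / n) atTop (𝓝 0) := by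
    refine squeeze_zero (fun n => by positivity) (fun n => ?_) hmn
    gcongr
    rw [Real.sqrt_le_left (Nat.cast_nonneg _)]
    exact_mod_cast Nat.le_self_pow two_ne_zero _
  refine tendstoInDistribution_sum_smul hμ2 hμ0 integral_id_multivariateGaussian hcov
    (W := fun n i ω => √(m n : ℝ) * w n i ω) (Y := fun n i ω => H (u n i ω))
    (D := fun n ω => (⨆ i, √(m n : ℝ) * |w n i ω - 1 / (n : ℝ)|) + √(m n : ℝ) / n)
    (fun n i => (hwm n i).const_mul _)
    (fun n i => HasLaw.comp ⟨hHm.aemeasurable, rfl⟩ (hu_law n i))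
    (fun n => (hu_indep n).comp _ fun _ => hHm)
    (fun n => (hwu n).comp (φ := fun x i => √(m n : ℝ) * x i) (ψ := fun y i => H (y i))
      (by fun_prop) (by fun_prop))
    (fun n i ω => ?_) (hw.max_tendsto.add_const_tendsto_zero hsqrt)
    (hw.tendstoInMeasure_sum_sq hmn) (fun n => ?_) ?_
  · calc |√(m n : ℝ) * w n i ω|
        = |√(m n : ℝ) * (w n i ω - 1 / (n : ℝ)) + √(m n : ℝ) / n| := by congr 1; ring
      _ ≤ |√(m n : ℝ) * (w n i ω - 1 / (n : ℝ))| + |√(m n : ℝ) / n| := abs_add_le _ _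
      _ = √(m n : ℝ) * |w n i ω - 1 / (n : ℝ)| + √(m n : ℝ) / n := by
          rw [abs_mul, abs_of_nonneg (Real.sqrt_nonneg _),
            abs_of_nonneg (by positivity : 0 ≤ √(m n : ℝ) / n)]
      _ ≤ _ := by
          gcongr
          exact le_ciSup (f := fun i => √(m n : ℝ) * |w n i ω - 1 / (n : ℝ)|)
            (Set.finite_range _).bddAbove i
  · have hGu : ∀ i, AEMeasurable (fun ω => G (u n i ω)) P := fun i =>
      AEMeasurable.comp_aemeasurable (g := G) (by rwa [(hu_law n i).map_eq]) (hum n i)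
    have hsum : AEMeasurable (fun ω => ∑ i, w n i ω • G (u n i ω)) P :=
      Finset.aemeasurable_fun_sum _ fun i _ => (hwm n i).smul (hGu i)
    exact (hsum.sub_const (gradient g θ)).const_smul √(m n : ℝ)
  -- For `n = 0` the weights sum to zero, and the two sides differ by a multiple of `∇g(θ)`.
  · filter_upwards [eventually_ge_atTop 1] with n hn
    have hHu : ∀ᵐ ω ∂P, ∀ i, H (u n i ω) = -gradient g θ + G (u n i ω) :=
      ae_all_iff.2 fun i => ae_of_ae_map (hum n i) (by rwa [(hu_law n i).map_eq])
    filter_upwards [hw.sum_eq_one n hn, hHu] with ω hω hHω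
    simp_rw [hHω, smul_add, Finset.sum_add_distrib, mul_smul, ← Finset.smul_sum,
      ← Finset.sum_smul, hω, one_smul, ← smul_add]
    congr 1
    exact sub_eq_neg_add _ _
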